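/- **Theorem.** Consider structures $\mathfrak M=\langle B,Q;\mathrm{Ob},\mathrm{IOb},\mathrm{Ph},+,\cdot,\le,W\rangle$, where $B$ (bodies) and $Q$ (quantities) are nonempty sets, $\mathrm{Ob}$ (observers), $\mathrm{IOb}$ (inertial observers) and $\mathrm{Ph}$ (light signals) are subsets of $B$, $+$ and $\cdot$ are binary operations on $Q$, $\le$ is a binary relation on $Q$, and $W\subseteq B\times B\times Q^3$ is the worldview relation ($W(k,b,\bar x)$ means: $k$ coordinatizes $b$ at the point $\bar x=\langle x_1,x_2,x_3\rangle$, at instant $x_1$ and space location $\langle x_2,x_3\rangle$). The structure $\langle Q,+,\cdot,\le\rangle$ is the *quantity part* of $\mathfrak M$. If it is an ordered field, put $\mathrm{time}(\bar x,\bar y)=x_1-y_1$ and $\mathrm{space}^2(\bar x,\bar y)=(x_2-y_2)^2+(x_3-y_3)^2$. The axiom system $\mathsf{SpecRel}_0+\mathsf{AxThExp}$ in dimension $3$ consists of the following axioms. * $\mathsf{AxOField}$: $\langle Q,+,\cdot,\le\rangle$ is a (linearly) ordered field. * $\mathsf{AxPh}$: for every $m\in\mathrm{IOb}$ there is $c_m\in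 Q$ with $c_m>0$ such that for all $\bar x,\bar y\in Q^3$: there is $p\in\mathrm{Ph}$ with $W(m,p,\bar x)$ and $W(m,p,\bar y)$ if and only if $\mathrm{space}^2(\bar x,\bar y)=c_m^2\cdot\mathrm{time}(\bar x,\bar y)^2$. (This $c_m$ is unique; it is the speed of light according to $m$, and it may depend on $m$.) * $\mathsf{AxEv}$: for all $m,k\in\mathrm{IOb}$ and $\bar x\in Q^3$ there is $\bar y\in Q^3$ such that for all $b\in B$: $W(m,b,\bar x)$ if and only if $W(k,b,\bar y)$. * $\mathsf{AxSelf}$: for all $m\in\mathrm{IOb}$ and $\bar x\in Q^3$: $W(m,m,\bar x)$ if and only if $x_2=x_3=0$. * $\mathsf{AxThExp}$: $\mathrm{IOb}\neq\emptyset$, and for all $m\in\mathrm{IOb}$ and $\bar x,\bar y\in Q^3$ with $\mathrm{space}^2(\bar x,\bar y)<c_m^2\cdot\mathrm{time}(\bar x,\bar y)^2$ there is $k\in\mathrm{IOb}$ with $W(m,k,\bar x)$ and $W(m,k,\bar y)$. Let $\mathit{Num}_3(\mathsf{SpecRel}_0+\mathsf{AxThExp})$ be the class of the quantity parts of all models of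 these axioms. Then $$\mathit{Num}_3(\mathsf{SpecRel}_0+\mathsf{AxThExp})=\{\text{Euclidean fields}\},$$ where a Euclidean field is an ordered field in which every positive element has a square root. That is, the quantity part of every such model is a Euclidean field, and every Euclidean field is the quantity part of such a model. -/

import Mathlib

universe u

namespace SpaceTime

/-- A structure `⟨Q, +, ·, ≤⟩` for the quantity sort: a nonempty set with two binary operations
and a binary relation, on which no laws are imposed. -/
structure QuantityStructure where
  /-- the set `Q` of quantities -/
  carrier : Type u
  nonempty : Nonempty carrier
  add : carrier → carrier → carrier
  mul : carrier → carrier → carrier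
  le : carrier → carrier → Prop

/-- A (necessarily unique) way to see `⟨Q, +, ·, ≤⟩` as an ordered field: a linearly ordered
field structure on the set `Q` whose addition, multiplication and ordering are the given ones. -/
class OrderedFieldStructure (𝔔 : QuantityStructure.{u}) extends
    Field 𝔔.carrier, LinearOrder 𝔔.carrier, IsStrictOrderedRing 𝔔.carrier where
  add_eq : ∀ x y : 𝔔.carrier, x + y = 𝔔.add x y
  mul_eq : ∀ x y : 𝔔.carrier, x * y = 𝔔.mul x y
  le_iff : ∀ x y : 𝔔.carrier, x ≤ y ↔ 𝔔.le x y

/-- `⟨Q, +, ·, ≤⟩` is a Euclidean field: an ordered field in which every positive element has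
a square root. -/
def QuantityStructure.IsEuclideanField (𝔔 : QuantityStructure.{u}) : Prop :=
  ∃ _ : OrderedFieldStructure 𝔔, ∀ x : 𝔔.carrier, 0 < x → ∃ y : 𝔔.carrier, y ^ 2 = x

/-- Models of the two-sorted language `{B, Q; Ob, IOb, Ph, +, ·, ≤, W}` for spacetime
dimension `d`. Coordinate points are `d`-tuples indexed by `Fin d`; the coordinate with index `0`
is the time coordinate, all the others are spatial. -/
structure Model (d : ℕ) where
  /-- the quantity part `⟨Q, +, ·, ≤⟩` -/
  quantityPart : QuantityStructure.{u}
  /-- the set `B` of bodies -/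
  Body : Type u
  body_nonempty : Nonempty Body
  /-- observers -/
  Ob : Body → Prop
  /-- inertial observers -/
  IOb : Body → Prop
  /-- light signals -/
  Ph : Body → Prop
  /-- the worldview relation: `W k b x` says that `k` coordinatizes `b` at the point `x` -/
  W : Body → Body → (Fin d → quantityPart.carrier) → Prop

namespace Model

variable {d : ℕ}

/-- The quantities of a model. -/
abbrev Q (M : Model.{u} d) : Type u := M.quantityPart.carrier

/-- The event occurring for `m` at `x`: the set of bodies that `m` coordinatizes at `x`. -/
def ev (M : Model.{u} d) (m : M.Body) (x : Fin d → M.Q) : Set M.Body := {b | M.W m b x}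

/-- All inertial observers coordinatize the same set of events. -/
def AxEv (M : Model.{u} d) : Prop :=
  ∀ m k : M.Body, M.IOb m → M.IOb k → ∀ x : Fin d → M.Q, ∃ y : Fin d → M.Q, M.ev m x = M.ev k y

variable [NeZero d]

/-- Time difference of two coordinate points. -/
def time (M : Model.{u} d) [OrderedFieldStructure M.quantityPart] (x y : Fin d → M.Q) : M.Q :=
  x 0 - y 0

/-- Squared spatial distance of two coordinate points. -/
def space2 (M : Model.{u} d) [OrderedFieldStructure M.quantityPart] (x y : Fin d → M.Q) : M.Q :=
  ∑ i ∈ Finset.univ.erase (0 : Fin d), (x i - y i) ^ 2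

/-- For any inertial observer, the speed of light is a positive quantity which is the same
everywhere and in every direction, and light signals can be sent out everywhere and in every
direction. -/
def AxPh (M : Model.{u} d) [OrderedFieldStructure M.quantityPart] : Prop :=
  ∀ m : M.Body, M.IOb m → ∃ c : M.Q, 0 < c ∧ ∀ x y : Fin d → M.Q,
    (∃ p : M.Body, M.Ph p ∧ M.W m p x ∧ M.W m p y) ↔ M.space2 x y = c ^ 2 * M.time x y ^ 2

/-- `v` is the speed of light according to `m`. If `AxPh` holds, then for each inertial observer
`m` there is exactly one such `v`. -/
def IsLightSpeed (M : Model.{u} d) [OrderedFieldStructure M.quantityPart]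
    (m : M.Body) (v : M.Q) : Prop :=
  0 < v ∧ ∀ x y : Fin d → M.Q,
    (∃ p : M.Body, M.Ph p ∧ M.W m p x ∧ M.W m p y) → M.space2 x y = v ^ 2 * M.time x y ^ 2

/-- Any inertial observer is stationary relative to himself. -/
def AxSelf (M : Model.{u} d) [OrderedFieldStructure M.quantityPart] : Prop :=
  ∀ m : M.Body, M.IOb m → ∀ x : Fin d → M.Q, M.W m m x ↔ ∀ i : Fin d, i ≠ 0 → x i = 0

/-- There are inertial observers, and they can move along any straight line with any speed less
than the speed of light. -/
def AxThExp (M : Model.{u} d) [OrderedFieldStructure M.quantityPart] : Prop :=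
  (∃ h : M.Body, M.IOb h) ∧
    ∀ m : M.Body, M.IOb m → ∀ c : M.Q, M.IsLightSpeed m c → ∀ x y : Fin d → M.Q,
      M.space2 x y < c ^ 2 * M.time x y ^ 2 → ∃ k : M.Body, M.IOb k ∧ M.W m k x ∧ M.W m k y

/-- The axiom system `SpecRel₀ + AxThExp`, where `SpecRel₀` consists of `AxOField` (the quantity
part is an ordered field), `AxPh`, `AxEv` and `AxSelf`. -/
def SpecRel₀AxThExp (M : Model.{u} d) : Prop :=
  ∃ _ : OrderedFieldStructure M.quantityPart, M.AxPh ∧ M.AxEv ∧ M.AxSelf ∧ M.AxThExp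

end Model

/-- The class of the quantity parts of the `n`-dimensional models of the theory `Th`. -/
def Num (n : ℕ) (Th : Model.{u} n → Prop) : Set QuantityStructure.{u} :=
  {𝔔 | ∃ M : Model.{u} n, Th M ∧ M.quantityPart = 𝔔}

end SpaceTime

/-! Only light-relatedness is known to survive a change of observer, so the square root must come
from a configuration stated through that relation. Let `k` pass through `0` and `a` in the worldview
of `m`. In the coordinates of `k`, both points lie on the time axis, and `exists_configuration`
supplies points whose light relations carry over to `m`. There `a = v + w` with `v`, `w` null, and
some `x` is orthogonal to both with squared length opposite to that of `a`. The Gram determinant of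
`v, w, x` is `c ^ 2` times a squared determinant, so the squared length of `a` is a square
(`isSquare_of_configuration`). A vector of squared length `4 * (c ^ 2 * a)` then yields a root of
any positive scalar `a`.

Conversely, over a Euclidean field timelike vectors can be normalized, so a translation and a
half-turn take any timelike line to the time axis (`exists_poincareTransf`). This gives `AxThExp` in
Minkowski spacetime. -/

namespace SpaceTime

/-! ### Null vectors and light relations in the Minkowski form. -/

section Minkowski

variable {K : Type*} [Field K]

/-- The Minkowski form on `K³` with speed of light `c`. -/
def mink (c : K) (x y : Fin 3 → K) : K := c ^ 2 * x 0 * y 0 - x 1 * y 1 - x 2 * y 2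

lemma mink_comm (c : K) (x y : Fin 3 → K) : mink c x y = mink c y x := by
  simp only [mink]; ring

lemma mink_sub_self (c : K) (x y : Fin 3 → K) :
    mink c (x - y) (x - y) = mink c x x - 2 * mink c x y + mink c y y := by
  simp only [mink, Pi.sub_apply]; ring

lemma mink_sub_right (c : K) (x y z : Fin 3 → K) :
    mink c x (y - z) = mink c x y - mink c x z := by
  simp only [mink, Pi.sub_apply]; ring

lemma mink_smul_left (c s : K) (x y : Fin 3 → K) : mink c (s • x) y = s * mink c x y := by
  simp only [mink, Pi.smul_apply, smul_eq_mul]; ring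

lemma mink_smul_right (c s : K) (x y : Fin 3 → K) : mink c x (s • y) = s * mink c x y := by
  simp only [mink, Pi.smul_apply, smul_eq_mul]; ring

lemma mink_sub_left (c : K) (x y z : Fin 3 → K) :
    mink c (x - y) z = mink c x z - mink c y z := by
  simp only [mink, Pi.sub_apply]; ring

/-- Two points are light-related if their difference is a null vector. -/
def LightRel (c : K) (x y : Fin 3 → K) : Prop := mink c (x - y) (x - y) = 0

lemma lightRel_iff (c : K) (x y : Fin 3 → K) :
    LightRel c x y ↔ (x 1 - y 1) ^ 2 + (x 2 - y 2) ^ 2 = c ^ 2 * (x 0 - y 0) ^ 2 := by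
  simp only [LightRel, mink, Pi.sub_apply]
  constructor <;> intro h <;> linear_combination -h

lemma lightRel_zero_right (c : K) (x : Fin 3 → K) : LightRel c x 0 ↔ mink c x x = 0 := by
  simp [LightRel]

/-- The Gram determinant of two null vectors and a third vector orthogonal to both. -/
lemma gram_det (c : K) (v w x : Fin 3 → K) (hv : mink c v v = 0) (hw : mink c w w = 0)
    (hvx : mink c v x = 0) (hwx : mink c w x = 0) :
    (c * Matrix.det !![v 0, v 1, v 2; w 0, w 1, w 2; x 0, x 1, x 2]) ^ 2
      = -(mink c v w ^ 2 * mink c x x) := by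
  -- The Gram determinant, expanded on the right, is `det ^ 2` times the determinant `c ^ 2` of the
  -- form.
  have key : (c * Matrix.det !![v 0, v 1, v 2; w 0, w 1, w 2; x 0, x 1, x 2]) ^ 2
      = mink c v v * (mink c w w * mink c x x - mink c w x ^ 2)
        - mink c v w * (mink c v w * mink c x x - mink c w x * mink c v x)
        + mink c v x * (mink c v w * mink c w x - mink c w w * mink c v x) := by
    simp [Matrix.det_fin_three, mink]
    ring
  rw [key, hv, hw, hvx, hwx]
  ring

variable [LinearOrder K] [IsStrictOrderedRing K]

/-- A null vector without time component vanishes. -/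
lemma null_eq_zero {c : K} {a : Fin 3 → K} (ha : mink c a a = 0) (h0 : a 0 = 0) : a = 0 := by
  have h : a 1 ^ 2 + a 2 ^ 2 = 0 := by
    simp only [mink, h0] at ha
    linear_combination -ha
  have h1 : a 1 = 0 := by
    refine pow_eq_zero_iff two_ne_zero |>.1 (le_antisymm ?_ (sq_nonneg _))
    linarith [sq_nonneg (a 2)]
  have h2 : a 2 = 0 := by
    refine pow_eq_zero_iff two_ne_zero |>.1 (le_antisymm ?_ (sq_nonneg _))
    linarith [sq_nonneg (a 1)]
  funext i
  fin_cases i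
  exacts [h0, h1, h2]

/-- Orthogonal null vectors are proportional. -/
lemma null_proportional {c : K} {a b : Fin 3 → K} (ha : mink c a a = 0) (hb : mink c b b = 0)
    (hab : mink c a b = 0) : b 0 • a = a 0 • b := by
  -- The difference of the two sides is null and has no time component.
  refine sub_eq_zero.1 (null_eq_zero (c := c) ?_ ?_)
  · rw [mink_sub_self]
    simp only [mink_smul_left, mink_smul_right, ha, hb, hab]
    ring
  · simp [mul_comm]

/-- A vector which is light-related to no point of a null line through the origin is orthogonal
to that line. -/
lemma mink_eq_zero_of_not_lightRel {c : K} {v x : Fin 3 → K} (hv : LightRel c v 0)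
    (h : ∀ z, LightRel c z 0 → LightRel c z v → ¬ LightRel c z x) : mink c v x = 0 := by
  rw [lightRel_zero_right] at hv
  by_contra hne
  -- For null `v`, the equation saying that `s • v - x` is null is linear in `s`; this is its
  -- solution.
  refine h ((mink c x x / (2 * mink c v x)) • v) ?_ ?_ ?_
  · rw [lightRel_zero_right, mink_smul_left, mink_smul_right, hv]; simp
  · rw [LightRel, mink_sub_self, mink_smul_left, mink_smul_right, mink_smul_left, hv]; simp
  · rw [LightRel, mink_sub_self, mink_smul_left, mink_smul_right, mink_smul_left, hv]
    field_simp
    ring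

/-- If every point of the null line through `0` and `v'` is light-related to some point of the
null line through `v` and `a`, then the two lines are parallel. -/
lemma mink_eq_zero_of_lightRel_lines {c : K} {a v v' : Fin 3 → K} (ha : ¬ LightRel c a 0)
    (hv : LightRel c v 0) (hva : LightRel c v a) (hv' : LightRel c v' 0)
    (hvv' : ¬ LightRel c v' v)
    (h : ∀ z, LightRel c z 0 → LightRel c z v' →
      ∃ y, LightRel c y v ∧ LightRel c y a ∧ LightRel c z y) :
    mink c v' (a - v) = 0 := by
  simp only [lightRel_zero_right] at ha hv hv' h
  have hw : mink c (a - v) (a - v) = 0 := by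
    rw [LightRel, mink_sub_self] at hva
    rw [mink_sub_self, mink_comm c a v]; linear_combination hva
  set w := a - v with hwdef
  have hvw : mink c v w ≠ 0 := by
    intro h0
    apply ha
    have : mink c a a = mink c v v + 2 * mink c v w + mink c w w := by
      simp only [hwdef, mink, Pi.sub_apply]; ring
    rw [this, hv, hw, h0]; ring
  by_contra hne
  -- With this `s`, whether `s • v'` and `v + r • w` are light-related does not depend on `r`; it
  -- would force `v'` and `v` to be orthogonal, hence light-related.
  set s := mink c v w / mink c v' w with hs
  have hs0 : s ≠ 0 := div_ne_zero hvw hne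
  have hsw : s * mink c v' w = mink c v w := div_mul_cancel₀ _ hne
  obtain ⟨y, hyv, hya, hzy⟩ := h (s • v')
    (by rw [mink_smul_left, mink_smul_right, hv']; simp)
    (by rw [LightRel, mink_sub_self, mink_smul_left, mink_smul_right, mink_smul_left, hv']; simp)
  have hyw : mink c (y - v) w = 0 := by
    have e : y - a = (y - v) - w := by rw [hwdef]; abel
    rw [LightRel, e, mink_sub_self, hw] at hya
    rw [LightRel] at hyv
    linarith
  have hw0 : w 0 ≠ 0 := by
    intro h0
    rw [null_eq_zero hw h0] at hvw
    simp [mink] at hvw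
  obtain ⟨r, hy⟩ : ∃ r : K, y = v + r • w := by
    refine ⟨(y - v) 0 / w 0, ?_⟩
    rw [div_eq_inv_mul, mul_smul, ← null_proportional hyv hw hyw, smul_smul, inv_mul_cancel₀ hw0]
    simp
  have hexp : mink c (s • v' - y) (s • v' - y) = s ^ 2 * mink c v' v' + mink c v v
      + r ^ 2 * mink c w w - 2 * s * mink c v' v - 2 * r * (s * mink c v' w - mink c v w) := by
    simp only [hy, mink, Pi.sub_apply, Pi.add_apply, Pi.smul_apply, smul_eq_mul]; ring
  rw [LightRel, hexp, hv', hv, hw, hsw] at hzy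
  have hv'v : mink c v' v = 0 := by
    have : s * mink c v' v = 0 := by linarith
    exact (mul_eq_zero.1 this).resolve_left hs0
  apply hvv'
  rw [LightRel, mink_sub_self, hv', hv, hv'v]
  ring

/-! ### The configuration that forces a square. -/

/-- A configuration of events, described by light relations only, which forces the squared
length of `a` to be a square. -/
lemma isSquare_of_configuration {c : K} {a v v' x : Fin 3 → K} (ha : ¬ LightRel c a 0)
    (hv : LightRel c v 0) (hva : LightRel c v a) (hv' : LightRel c v' 0)
    (hvv' : ¬ LightRel c v' v) (hxa : LightRel c x a)
    (hxv : ∀ z, LightRel c z 0 → LightRel c z v → ¬ LightRel c z x)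
    (hxv' : ∀ z, LightRel c z 0 → LightRel c z v' → ¬ LightRel c z x)
    (h : ∀ z, LightRel c z 0 → LightRel c z v' →
      ∃ y, LightRel c y v ∧ LightRel c y a ∧ LightRel c z y) :
    ∃ s : K, (c * s) ^ 2 = mink c a a := by
  have hpar := mink_eq_zero_of_lightRel_lines ha hv hva hv' hvv' h
  have hvx := mink_eq_zero_of_not_lightRel hv hxv
  have hv'x := mink_eq_zero_of_not_lightRel hv' hxv'
  rw [lightRel_zero_right] at ha hv hv'
  have hw : mink c (a - v) (a - v) = 0 := by
    rw [LightRel, mink_sub_self] at hva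
    rw [mink_sub_self, mink_comm c a v]; linear_combination hva
  have hwx : mink c (a - v) x = 0 := by
    have h0 : v' 0 ≠ 0 := by
      intro h0
      apply hvv'
      rw [null_eq_zero hv' h0, LightRel, mink_sub_self, hv]
      simp [mink]
    have h1 := congrArg (fun y => mink c y x) (null_proportional hv' hw hpar)
    simp only [mink_smul_left, hv'x, mul_zero] at h1
    exact (mul_eq_zero.1 h1.symm).resolve_left h0
  have hva' : 2 * mink c v (a - v) = mink c a a := by
    rw [LightRel, mink_sub_self] at hva
    rw [mink_sub_right]; linear_combination -hva - hv
  -- Since `a = v + (a - v)` is orthogonal to `x`, the null vector `x - a` has squared length `mink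
  -- c x x + mink c a a`.
  have hax : mink c x x = - mink c a a := by
    rw [LightRel, mink_sub_self, mink_comm c x a] at hxa
    rw [mink_sub_left, hvx] at hwx
    linear_combination hxa + 2 * hwx
  have hg := gram_det c v (a - v) x hv hw hvx hwx
  have hb : mink c v (a - v) ≠ 0 := by
    intro h0; apply ha; rw [← hva', h0, mul_zero]
  refine ⟨Matrix.det !![v 0, v 1, v 2; (a - v) 0, (a - v) 1, (a - v) 2; x 0, x 1, x 2] /
    mink c v (a - v), ?_⟩
  rw [← mul_div_assoc, div_pow, hg, hax]
  field_simp

/-- Two points on the time axis which are not light-related complete to a configuration as in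
`isSquare_of_configuration`. -/
lemma exists_configuration {c : K} (hc : 0 < c) {o a : Fin 3 → K} (ho : ∀ i, i ≠ 0 → o i = 0)
    (ha : ∀ i, i ≠ 0 → a i = 0) (hao : ¬ LightRel c a o) :
    ∃ v v' x : Fin 3 → K, LightRel c v o ∧ LightRel c v a ∧ LightRel c v' o ∧
      ¬ LightRel c v' v ∧ LightRel c x a ∧
      (∀ z, LightRel c z o → LightRel c z v → ¬ LightRel c z x) ∧
      (∀ z, LightRel c z o → LightRel c z v' → ¬ LightRel c z x) ∧
      ∀ z, LightRel c z o → LightRel c z v' →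
        ∃ y, LightRel c y v ∧ LightRel c y a ∧ LightRel c z y := by
  have ho1 := ho 1 (by decide)
  have ho2 := ho 2 (by decide)
  have ha1 := ha 1 (by decide)
  have ha2 := ha 2 (by decide)
  obtain ⟨d, hd⟩ : ∃ d, a 0 = o 0 + 2 * d := ⟨(a 0 - o 0) / 2, by ring⟩
  have hd0 : d ≠ 0 := by
    rintro rfl
    apply hao
    simp [lightRel_iff, ho1, ho2, ha1, ha2, hd]
  have hcd : c * d ≠ 0 := mul_ne_zero hc.ne' hd0
  -- the points of the null line through `o` in direction `(1, ±c, 0)`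
  have line : ∀ e : K, e ^ 2 = 1 → ∀ z, LightRel c z o →
      LightRel c z ![o 0 + d, e * (c * d), 0] → z 1 = e * c * (z 0 - o 0) ∧ z 2 = 0 := by
    intro e he z h1 h2
    rw [lightRel_iff] at h1 h2
    simp only [ho1, ho2, Matrix.cons_val, sub_zero] at h1 h2
    have h3 : z 1 = e * c * (z 0 - o 0) := by
      have : (c * d) * (e * z 1 - c * (z 0 - o 0)) = 0 := by
        linear_combination (h1 - h2) / 2 + c ^ 2 * d ^ 2 / 2 * he
      have h4 := (mul_eq_zero.1 this).resolve_left hcd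
      linear_combination e * h4 - z 1 * he
    refine ⟨h3, ?_⟩
    rw [h3] at h1
    refine pow_eq_zero_iff two_ne_zero |>.1 ?_
    linear_combination h1 - c ^ 2 * (z 0 - o 0) ^ 2 * he
  -- The spatial offset `2 * (c * d)` is perpendicular to the plane of both null lines, so it adds a
  -- positive term to an already balanced equation.
  have far : ∀ e : K, e ^ 2 = 1 → ∀ z, LightRel c z o →
      LightRel c z ![o 0 + d, e * (c * d), 0] →
      ¬ LightRel c z ![o 0, 0, 2 * (c * d)] := by
    intro e he z h1 h2 h3
    obtain ⟨h4, h5⟩ := line e he z h1 h2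
    rw [lightRel_iff] at h3
    simp only [h4, h5, Matrix.cons_val, sub_zero] at h3
    apply pow_ne_zero 2 hcd
    linear_combination h3 / 4 - c ^ 2 * (z 0 - o 0) ^ 2 / 4 * he
  refine ⟨![o 0 + d, 1 * (c * d), 0], ![o 0 + d, (-1) * (c * d), 0], ![o 0, 0, 2 * (c * d)],
    ?_, ?_, ?_, ?_, ?_, far 1 (by ring), far (-1) (by ring), ?_⟩
  · simp only [lightRel_iff, ho1, ho2, Matrix.cons_val]; ring
  · simp only [lightRel_iff, ha1, ha2, hd, Matrix.cons_val]; ring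
  · simp only [lightRel_iff, ho1, ho2, Matrix.cons_val]; ring
  · simp only [lightRel_iff, Matrix.cons_val]
    intro h
    apply pow_ne_zero 2 hcd
    linear_combination h / 4
  · simp only [lightRel_iff, ha1, ha2, hd, Matrix.cons_val]; ring
  · intro z h1 h2
    obtain ⟨h4, h5⟩ := line (-1) (by ring) z h1 h2
    -- Translation by the null vector `v - o` carries the line through `o` and `v'` to the line
    -- through `v` and `a`.
    refine ⟨![z 0 + d, z 1 + c * d, 0], ?_, ?_, ?_⟩
    · simp only [lightRel_iff, h4, Matrix.cons_val]; ring
    · simp only [lightRel_iff, h4, ha1, ha2, hd, Matrix.cons_val]; ring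
    · simp only [lightRel_iff, h5, Matrix.cons_val]; ring

/-! ### Half-turns and Poincaré transformations. -/

/-- The half-turn about the axis `e₀ + t` exchanges the unit timelike vectors `e₀` and `t`. -/
def halfTurn (t x : Fin 3 → K) : Fin 3 → K :=
  (mink 1 x (![1, 0, 0] + t) / (1 + t 0)) • (![1, 0, 0] + t) - x

/-- This explains the denominator in `halfTurn`: a half-turn about `u` is `x ↦ (2 * mink 1 x u /
mink 1 u u) • u - x`. -/
lemma mink_axis_add_self {t : Fin 3 → K} (ht : mink 1 t t = 1) :
    mink 1 (![1, 0, 0] + t) (![1, 0, 0] + t) = 2 * (1 + t 0) := by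
  simp [mink] at ht ⊢
  linear_combination ht

lemma halfTurn_halfTurn {t : Fin 3 → K} (ht : mink 1 t t = 1) (h0 : 1 + t 0 ≠ 0)
    (x : Fin 3 → K) : halfTurn t (halfTurn t x) = x := by
  have h : mink 1 (halfTurn t x) (![1, 0, 0] + t) = mink 1 x (![1, 0, 0] + t) := by
    rw [halfTurn, mink_sub_left, mink_smul_left, mink_axis_add_self ht]
    field_simp
    ring
  rw [halfTurn, h, halfTurn]
  abel

lemma mink_halfTurn {t : Fin 3 → K} (ht : mink 1 t t = 1) (h0 : 1 + t 0 ≠ 0)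
    (x y : Fin 3 → K) :
    mink 1 (halfTurn t x - halfTurn t y) (halfTurn t x - halfTurn t y)
      = mink 1 (x - y) (x - y) := by
  have h : halfTurn t x - halfTurn t y =
      (mink 1 (x - y) (![1, 0, 0] + t) / (1 + t 0)) • (![1, 0, 0] + t) - (x - y) := by
    rw [mink_sub_left, sub_div, sub_smul, halfTurn, halfTurn]
    abel
  rw [h, mink_sub_self, mink_smul_left, mink_smul_left, mink_smul_right, mink_axis_add_self ht,
    mink_comm 1 _ (x - y)]
  field_simp
  ring

lemma halfTurn_smul {t : Fin 3 → K} (ht : mink 1 t t = 1) (h0 : 1 + t 0 ≠ 0) (r : K) :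
    halfTurn t (r • t) = ![r, 0, 0] := by
  have h : mink 1 t (![1, 0, 0] + t) = 1 + t 0 := by
    simp [mink] at ht ⊢
    linear_combination ht
  rw [halfTurn, mink_smul_left, h, mul_div_cancel_right₀ _ h0]
  funext i
  simp only [Pi.sub_apply, Pi.smul_apply, Pi.add_apply, smul_eq_mul]
  fin_cases i <;> simp [mul_add]

/-- The bijections of `K³` which preserve the Minkowski form of differences. -/
abbrev PoincareTransf (K : Type*) [Field K] : Type _ :=
  {f : (Fin 3 → K) ≃ (Fin 3 → K) //
    ∀ x y, mink 1 (f x - f y) (f x - f y) = mink 1 (x - y) (x - y)}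

/-- Over a Euclidean field, a Poincaré transformation takes any given timelike line to the
time axis. -/
lemma exists_poincareTransf (hK : ∀ a : K, 0 < a → ∃ b, b ^ 2 = a) {x y : Fin 3 → K}
    (hxy : 0 < mink 1 (x - y) (x - y)) :
    ∃ f : PoincareTransf K, ∀ i, i ≠ 0 → f.1 x i = 0 ∧ f.1 y i = 0 := by
  obtain ⟨r, t, ht, ht0, hrt⟩ : ∃ (r : K) (t : Fin 3 → K), mink 1 t t = 1 ∧ 1 + t 0 ≠ 0 ∧
      x - y = r • t := by
    obtain ⟨r, hr⟩ := hK _ hxy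
    have hr0 : r ≠ 0 := by
      rintro rfl
      rw [← hr] at hxy
      simp at hxy
    have key : ∀ s : K, s ^ 2 = mink 1 (x - y) (x - y) → s ≠ 0 →
        mink 1 (s⁻¹ • (x - y)) (s⁻¹ • (x - y)) = 1 ∧ x - y = s • s⁻¹ • (x - y) := by
      intro s hs hs0
      rw [mink_smul_left, mink_smul_right, ← hs, smul_smul, mul_inv_cancel₀ hs0, one_smul]
      refine ⟨?_, rfl⟩
      field_simp
    -- The half-turn needs `1 + t 0 ≠ 0`; if this fails, the opposite root `-r` replaces `t` by
    -- `-t`.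
    by_cases h : 1 + (r⁻¹ • (x - y)) 0 = 0
    · obtain ⟨h1, h2⟩ := key (-r) (by rw [neg_sq, hr]) (neg_ne_zero.2 hr0)
      refine ⟨-r, (-r)⁻¹ • (x - y), h1, ?_, h2⟩
      intro h3
      rw [inv_neg, neg_smul, Pi.neg_apply] at h3
      linarith
    · obtain ⟨h1, h2⟩ := key r hr hr0
      exact ⟨r, r⁻¹ • (x - y), h1, h, h2⟩
  have hinv := halfTurn_halfTurn ht ht0
  refine ⟨⟨(Equiv.subRight y).trans ⟨halfTurn t, halfTurn t, hinv, hinv⟩, ?_⟩, ?_⟩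
  · intro a b
    simp only [Equiv.trans_apply, Equiv.subRight_apply, Equiv.coe_fn_mk]
    rw [mink_halfTurn ht ht0, sub_sub_sub_cancel_right]
  · intro i hi
    have hy : y - y = (0 : K) • t := by simp
    simp only [Equiv.trans_apply, Equiv.subRight_apply, Equiv.coe_fn_mk]
    rw [hrt, hy, halfTurn_smul ht ht0, halfTurn_smul ht ht0]
    fin_cases i <;> simp at hi ⊢

end Minkowski

/-! ### Quantity parts of models are Euclidean. -/

namespace Model

lemma space2_eq (M : Model.{u} 3) [OrderedFieldStructure M.quantityPart] (x y : Fin 3 → M.Q) :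
    M.space2 x y = (x 1 - y 1) ^ 2 + (x 2 - y 2) ^ 2 := by
  have h : Finset.univ.erase (0 : Fin 3) = {1, 2} := by decide
  rw [space2, h, Finset.sum_pair (by decide)]

/-- Two events are light-related if they share a light signal. -/
def LightEv (M : Model.{u} 3) (E F : Set M.Body) : Prop := ∃ p, M.Ph p ∧ p ∈ E ∧ p ∈ F

lemma exists_lightEv_iff {M : Model.{u} 3} [OrderedFieldStructure M.quantityPart]
    (hPh : M.AxPh) {m : M.Body} (hm : M.IOb m) :
    ∃ c : M.Q, 0 < c ∧ ∀ x y, M.LightEv (M.ev m x) (M.ev m y) ↔ LightRel c x y := by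
  obtain ⟨c, hc, h⟩ := hPh m hm
  refine ⟨c, hc, fun x y => ?_⟩
  rw [lightRel_iff, ← space2_eq]
  exact h x y

/-- The squared length of a vector along the worldline of an inertial observer is a square. -/
lemma isSquare_of_worldline {M : Model.{u} 3} [OrderedFieldStructure M.quantityPart]
    (hPh : M.AxPh) (hEv : M.AxEv) (hSelf : M.AxSelf) {m k : M.Body} (hm : M.IOb m)
    (hk : M.IOb k) {c : M.Q}
    (hc : ∀ x y, M.LightEv (M.ev m x) (M.ev m y) ↔ LightRel c x y) {a : Fin 3 → M.Q}
    (ha : mink c a a ≠ 0) (h0 : M.W m k 0) (hka : M.W m k a) :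
    ∃ s : M.Q, (c * s) ^ 2 = mink c a a := by
  obtain ⟨c', hc'0, hc'⟩ := exists_lightEv_iff hPh hk
  -- The maps `f` and `g` need not be mutually inverse: matching events have the same light
  -- relations, which suffices.
  choose g hg using hEv m k hm hk
  choose f hf using hEv k m hk hm
  have hgg : ∀ x y, LightRel c x y ↔ LightRel c' (g x) (g y) := by
    intro x y; rw [← hc, ← hc', hg, hg]
  have hgf : ∀ x y, LightRel c x (f y) ↔ LightRel c' (g x) y := by
    intro x y; rw [← hc, ← hc', hg, ← hf]
  have hfg : ∀ x y, LightRel c (f x) y ↔ LightRel c' x (g y) := by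
    intro x y; rw [← hc, ← hc', hg y, ← hf]
  have hff : ∀ x y, LightRel c (f x) (f y) ↔ LightRel c' x y := by
    intro x y; rw [← hc, ← hc', hf, hf]
  have axis : ∀ x, M.W m k x → ∀ i, i ≠ 0 → g x i = 0 := by
    intro x hx
    rw [← hSelf k hk]
    have : k ∈ M.ev m x := hx
    rwa [hg] at this
  have ha0 : ¬ LightRel c a 0 := by rwa [lightRel_zero_right]
  obtain ⟨v, v', x, h1, h2, h3, h4, h5, h6, h7, h8⟩ :=
    exists_configuration hc'0 (axis 0 h0) (axis a hka) (by rwa [← hgg])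
  refine isSquare_of_configuration (v := f v) (v' := f v') (x := f x) ha0 ((hfg _ _).2 h1)
    ((hfg _ _).2 h2) ((hfg _ _).2 h3) (by rwa [hff]) ((hfg _ _).2 h5) ?_ ?_ ?_
  · intro z
    rw [hgg, hgf, hgf]
    exact h6 _
  · intro z
    rw [hgg, hgf, hgf]
    exact h7 _
  · intro z
    rw [hgg, hgf]
    intro hz hz'
    obtain ⟨y, hy1, hy2, hy3⟩ := h8 _ hz hz'
    exact ⟨f y, (hff _ _).2 hy1, (hfg _ _).2 hy2, (hgf _ _).2 hy3⟩

theorem isEuclideanField_quantityPart {M : Model.{u} 3} (hM : M.SpecRel₀AxThExp) :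
    M.quantityPart.IsEuclideanField := by
  obtain ⟨inst, hPh, hEv, hSelf, ⟨m, hm⟩, hTh⟩ := hM
  refine ⟨inst, fun a ha => ?_⟩
  obtain ⟨c, hc0, hc⟩ := exists_lightEv_iff hPh hm
  have hlight : M.IsLightSpeed m c := by
    refine ⟨hc0, fun x y h => ?_⟩
    rw [space2_eq]
    exact (lightRel_iff c x y).1 ((hc x y).1 h)
  -- The test vector rests on `(1 + a) ^ 2 - (1 - a) ^ 2 = 4 * a`, which makes it timelike without
  -- any root.
  have hca : 0 < c ^ 2 * a := mul_pos (pow_pos hc0 2) ha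
  have hmink : mink c ![1 + a, c * (1 - a), 0] ![1 + a, c * (1 - a), 0] = 4 * (c ^ 2 * a) := by
    simp [mink]
    ring
  obtain ⟨k, hk, h0, hka⟩ := hTh m hm c hlight 0 ![1 + a, c * (1 - a), 0] (by
    rw [space2_eq, time]
    simp
    linear_combination 4 * hca)
  obtain ⟨s, hs⟩ := isSquare_of_worldline hPh hEv hSelf hm hk hc
    (by rw [hmink]; exact (mul_pos four_pos hca).ne') h0 hka
  refine ⟨s / 2, ?_⟩
  rw [hmink] at hs
  have h1 : c ^ 2 * ((s / 2) ^ 2 - a) = 0 := by linear_combination hs / 4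
  exact sub_eq_zero.1 ((mul_eq_zero.1 h1).resolve_left (pow_ne_zero 2 hc0.ne'))

end Model

/-! ### Minkowski spacetime over a Euclidean field. -/

/-- Lightlike lines, given by a point and a nonzero null direction. -/
abbrev LightLine (K : Type*) [Field K] : Type _ :=
  (Fin 3 → K) × {v : Fin 3 → K // v ≠ 0 ∧ mink 1 v v = 0}

/-- Minkowski spacetime over an ordered field: the inertial observers are the Poincaré
transformations (from their own coordinates to fixed reference coordinates), the light signals
are the lightlike lines of the reference coordinates. -/
abbrev minkowskiModel (𝔔 : QuantityStructure.{u}) [OrderedFieldStructure 𝔔] : Model.{u} 3 where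
  quantityPart := 𝔔
  Body := PoincareTransf 𝔔.carrier ⊕ LightLine 𝔔.carrier
  body_nonempty := ⟨Sum.inl ⟨Equiv.refl _, fun _ _ => rfl⟩⟩
  Ob b := b.isLeft
  IOb b := b.isLeft
  Ph b := b.isRight
  W
    | .inl m, .inl k, x => ∀ i, i ≠ 0 → k.1.symm (m.1 x) i = 0
    | .inl m, .inr p, x => ∃ s : 𝔔.carrier, m.1 x = p.1 + s • p.2.1
    | .inr _, _, _ => False

theorem minkowskiModel_specRel (𝔔 : QuantityStructure.{u}) [inst : OrderedFieldStructure 𝔔]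
    (h𝔔 : ∀ x : 𝔔.carrier, 0 < x → ∃ y : 𝔔.carrier, y ^ 2 = x) :
    (minkowskiModel 𝔔).SpecRel₀AxThExp := by
  let _ : OrderedFieldStructure (minkowskiModel 𝔔).quantityPart := inst
  have hlight : ∀ (m : PoincareTransf 𝔔.carrier) (x y : Fin 3 → 𝔔.carrier),
      (∃ p : (minkowskiModel 𝔔).Body, (minkowskiModel 𝔔).Ph p ∧
        (minkowskiModel 𝔔).W (.inl m) p x ∧ (minkowskiModel 𝔔).W (.inl m) p y) ↔
      LightRel 1 x y := by
    intro m x y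
    constructor
    · rintro ⟨p | p, hp, hx, hy⟩
      · simp at hp
      · obtain ⟨s, hs⟩ := hx
        obtain ⟨r, hr⟩ := hy
        rw [LightRel, ← m.2, hs, hr, add_sub_add_left_eq_sub, ← sub_smul, mink_smul_left,
          mink_smul_right, p.2.2.2]
        simp
    · intro h
      by_cases hxy : x = y
      · subst hxy
        -- Coinciding points determine no direction, so any null direction serves.
        refine ⟨.inr (m.1 x, ⟨![1, 1, 0], ?_, ?_⟩), rfl, ⟨0, ?_⟩, ⟨0, ?_⟩⟩
        · intro h0
          simpa using congrFun h0 0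
        · simp [mink]
        · simp
        · simp
      · refine ⟨.inr (m.1 y, ⟨m.1 x - m.1 y, ?_, ?_⟩), rfl, ⟨1, ?_⟩, ⟨0, ?_⟩⟩
        · exact sub_ne_zero.2 (m.1.injective.ne hxy)
        · rw [m.2]; exact h
        · simp
        · simp
  refine ⟨inst, ?_, ?_, ?_, ⟨.inl ⟨Equiv.refl _, fun _ _ => rfl⟩, rfl⟩, ?_⟩
  · rintro (m | m) hm
    · refine ⟨1, one_pos, fun x y => ?_⟩
      rw [Model.space2_eq]
      exact (hlight m x y).trans (lightRel_iff 1 x y)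
    · simp at hm
  · rintro (m | m) (k | k) hm hk x
    · refine ⟨k.1.symm (m.1 x), ?_⟩
      ext (b | b) <;> simp [Model.ev, minkowskiModel]
    all_goals simp at hm hk
  · rintro (m | m) hm x
    · simp [minkowskiModel]
    · simp at hm
  · rintro (m | m) hm c ⟨-, hc⟩ x y hxy
    · have hc1 : c ^ 2 = 1 := by
        have h := hc ![1, 1, 0] 0 ((hlight m _ _).2 (by simp [lightRel_iff]))
        rw [Model.space2_eq, Model.time] at h
        simpa using h.symm
      rw [Model.space2_eq, Model.time, hc1] at hxy
      obtain ⟨f, hf⟩ := exists_poincareTransf h𝔔 (x := m.1 x) (y := m.1 y) (by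
        rw [m.2]
        simp only [mink, Pi.sub_apply]
        linear_combination hxy)
      -- Observers map their own coordinates to the reference ones, so the observer whose time axis
      -- is the given line is the inverse of `f`.
      refine ⟨.inl ⟨f.1.symm, fun a b => ?_⟩, rfl, fun i hi => (hf i hi).1,
        fun i hi => (hf i hi).2⟩
      rw [← f.2]
      simp
    · simp at hm

end SpaceTime

theorem theorem3p8 :
    SpaceTime.Num.{u} 3 SpaceTime.Model.SpecRel₀AxThExp =
      {𝔔 : SpaceTime.QuantityStructure.{u} | 𝔔.IsEuclideanField} := by
  ext 𝔔
  constructor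
  · rintro ⟨M, hM, rfl⟩
    exact SpaceTime.Model.isEuclideanField_quantityPart hM
  · rintro ⟨inst, h⟩
    exact ⟨SpaceTime.minkowskiModel 𝔔, SpaceTime.minkowskiModel_specRel 𝔔 h, rfl⟩
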